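/- Let $M$ be a smooth four-dimensional manifold with a smooth Lorentzian metric $g$ of signature $(1,3)$, let $D$ be its Levi-Civita connection, and let $\{e_0,e_1,e_2,e_3\}$ be a global smooth tetrad, $g(e_a,e_b)=\eta_{ab}=\mathrm{diag}(1,-1,-1,-1)$, with reciprocal frame $e^b=\eta^{bb}e_b$. Let $\mathcal{C}\ell(TM)$ be the Clifford bundle, with $vw+wv=2g(v,w)$ and product written by juxtaposition, let $D$ act on Clifford fields by $D_vC=\partial_vC+\tfrac12[\omega_v,C]$, where $\partial_v$ differentiates the components of $C$ in the frame of multivectors given by the tetrad, $D_ve_a=\omega^b_{va}e_b$ and $\omega_v=\tfrac12\,\omega_v^{bc}e_be_c$ with $\omega_v^{bc}=\eta^{cc}\omega^b_{vc}$. Put $\sigma_i=e_ie_0$ for $i=1,2,3$. (1) At every point and for every tangent vector $v$ there (in particular for the coordinate vectors $e_\mu$ of a chart): $D_v\sigma_i=0$ for all $i=1,2,3$ if and only if $$D_ve_i=e_i(D_ve_0)e_0\quad\text{for all } i=1,2,3,$$ and also if and only if $\omega^b_{vi}=e^b\lrcorner(\omega^a_{v0}\,e_ie_ae_0)$ for all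 $i=1,2,3$ and $b=0,1,2,3$, as an equation in the Clifford algebra, $\lrcorner$ being the left contraction. For each single $i$, $D_v\sigma_i=0$ if and only if $D_ve_i=-e_i(D_ve_0)e_0$. (2) Suppose $De_0=0$. Then, for each $i$, $D\sigma_i=0$ if and only if $De_i=0$. If $D\sigma_i=0$ for all $i=1,2,3$, then the $e_i$ are Fermi transported along every integral line of $e_0$, $D_{e_a}e_b=0$ for all $a,b=0,1,2,3$, all the tetrad fields are parallel, $D$ is teleparallel (there is a global tetrad of parallel fields), and the curvature of $D$ vanishes. (3) Suppose only that $e_0$ is geodesic, $D_{e_0}e_0=0$. Then, for each $i$, the component along $e_0$ of the condition reduces to Fermi transport: $D_{e_0}\sigma_i=0$ on $M$ if and only if $D_{e_0}e_i=0$ on $M$, and if and only if $e_i$ is Fermi transported along every integral line of $e_0$. In particular, if $D\sigma_i=0$ for all $i=1,2,3$, then $D_{e_0}e_a=0$ for $a=0,1,2,3$ and all the $e_a$ are Fermi transported along every integral line of $e_0$. Here a field $Y$ is Fermi transported along the integral lines of the unit timelike field $u$ if on each of them $D_uY=g(u,Y)A-g(A,Y)u$ with $A=D_uu$. -/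

import Mathlib

open scoped Manifold ContDiff

noncomputable section

namespace Spacetime

/-- The model space of a four dimensional manifold. -/
abbrev E4 : Type := EuclideanSpace ℝ (Fin 4)

/-- The diagonal entries of `diag(1, -1, -1, -1)`. -/
def eta : Fin 4 → ℝ := ![1, -1, -1, -1]

/-- The entries `η_{ab}` of `diag(1, -1, -1, -1)`. -/
def etaMat (a b : Fin 4) : ℝ := if a = b then eta a else 0

section Geometry

variable (M : Type*) [TopologicalSpace M] [ChartedSpace E4 M] [IsManifold (𝓡 4) ∞ M]

/-- A vector field on `M` (no regularity included). -/
abbrev VField : Type _ := Π x : M, TangentSpace (𝓡 4) x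

/-- A linear connection (Koszul connection on the tangent bundle) of `M`.
`D Y x v` is `(D_v Y)(x)`, for a vector field `Y` and a tangent vector `v` at `x`. -/
abbrev LinearConnection : Type _ :=
  CovariantDerivative (𝓡 4) E4 (TangentSpace (𝓡 4) : M → Type _)

/-- A smooth Lorentzian metric of signature `(1, 3)`. -/
structure LorentzMetric where
  /-- The bilinear form on each tangent space. -/
  val (x : M) : TangentSpace (𝓡 4) x →L[ℝ] TangentSpace (𝓡 4) x →L[ℝ] ℝ
  symm (x : M) (v w : TangentSpace (𝓡 4) x) : val x v w = val x w v
  signature (x : M) : ∃ b : Module.Basis (Fin 4) ℝ (TangentSpace (𝓡 4) x),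
    ∀ i j, val x (b i) (b j) = etaMat i j
  contMDiff : ContMDiff (𝓡 4) ((𝓡 4).prod 𝓘(ℝ, E4 →L[ℝ] E4 →L[ℝ] ℝ)) ∞
    (fun x ↦ Bundle.TotalSpace.mk' (E4 →L[ℝ] E4 →L[ℝ] ℝ) x (val x))

variable {M}

/-- Smoothness of a vector field. -/
def IsSmooth (X : VField M) : Prop :=
  ContMDiff (𝓡 4) (𝓡 4).tangent ∞ (fun x ↦ (⟨x, X x⟩ : TangentBundle (𝓡 4) M))

/-- Differentiability of a vector field at a point. -/
def IsDiffAt (X : VField M) (x : M) : Prop :=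
  MDifferentiableAt (𝓡 4) (𝓡 4).tangent (fun y ↦ (⟨y, X y⟩ : TangentBundle (𝓡 4) M)) x

/-- `D` is the Levi-Civita connection of `g`: it has no torsion, and `Dg = 0`. -/
structure IsLeviCivita (D : LinearConnection M) (g : LorentzMetric M) : Prop where
  torsion_eq_zero : D.torsion = 0
  metric (Y Z : VField M) (x : M) (hY : IsDiffAt Y x) (hZ : IsDiffAt Z x)
    (v : TangentSpace (𝓡 4) x) :
    mvfderiv (𝓡 4) (fun y ↦ g.val y (Y y) (Z y)) x v =
      g.val x (D Y x v) (Z x) + g.val x (Y x) (D Z x v)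

/-- The curvature operator `D_X D_Y Z - D_Y D_X Z - D_{[X, Y]} Z`. -/
def curvature (D : LinearConnection M) (X Y Z : VField M) (x : M) : TangentSpace (𝓡 4) x :=
  D (fun y ↦ D Z y (Y y)) x (X x) - D (fun y ↦ D Z y (X y)) x (Y x)
    - D Z x (VectorField.mlieBracket (𝓡 4) X Y x)

/-- The curvature of `D` vanishes. -/
def IsFlat (D : LinearConnection M) : Prop :=
  ∀ X Y Z : VField M, IsSmooth X → IsSmooth Y → IsSmooth Z → ∀ x, curvature D X Y Z x = 0

variable (g : LorentzMetric M)

/-- A global tetrad: four smooth vector fields on `M`, orthonormal at every point. -/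
structure Tetrad where
  /-- The four vector fields. -/
  vec : Fin 4 → VField M
  smooth (a : Fin 4) : IsSmooth (vec a)
  orthonormal (a b : Fin 4) (x : M) : g.val x (vec a x) (vec b x) = etaMat a b

/-- `Y` is parallel: `D_v Y = 0` for all tangent vectors `v`. -/
def IsParallel (D : LinearConnection M) (Y : VField M) : Prop :=
  ∀ (x : M) (v : TangentSpace (𝓡 4) x), D Y x v = 0

/-- `D` is teleparallel: there is a global tetrad of parallel vector fields. -/
def IsTeleparallel (D : LinearConnection M) : Prop :=
  ∃ f : Tetrad g, ∀ a, IsParallel D (f.vec a)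

/-- `u` is a geodesic vector field: `D_u u = 0`. -/
def IsGeodesic (D : LinearConnection M) (u : VField M) : Prop :=
  ∀ x, D u x (u x) = 0

/-- The field `Y` is Fermi transported along every integral line `γ` of the unit timelike field
`u` (defined on an open interval `J`), that is, along each `γ` one has
`D_u Y = g(u, Y) A - g(A, Y) u`, where `A = D_u u` is the acceleration. -/
def IsFermiTransported (D : LinearConnection M) (u Y : VField M) : Prop :=
  ∀ (γ : ℝ → M) (J : Set ℝ), IsOpen J → J.OrdConnected → IsMIntegralCurveOn γ u J →
    ∀ t ∈ J, D Y (γ t) (u (γ t)) =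
      g.val (γ t) (u (γ t)) (Y (γ t)) • D u (γ t) (u (γ t))
        - g.val (γ t) (D u (γ t) (u (γ t))) (Y (γ t)) • u (γ t)

/-! ### The Clifford bundle of the tangent bundle -/

/-- The quadratic form `v ↦ g(v, v)` on the tangent space at `x`. -/
def LorentzMetric.quad (x : M) : QuadraticForm ℝ (TangentSpace (𝓡 4) x) :=
  LinearMap.BilinMap.toQuadraticMap
    (LinearMap.mk₂ ℝ (fun v w : TangentSpace (𝓡 4) x ↦ g.val x v w)
      (by simp) (by simp) (by simp) (by simp))

lemma LorentzMetric.quad_apply (x : M) (v : TangentSpace (𝓡 4) x) :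
    g.quad x v = g.val x v v := by
  simp [LorentzMetric.quad]

/-- The fibre at `x` of the Clifford bundle of `TM`: `v w + w v = 2 g(v, w)`. -/
abbrev Cl (x : M) : Type _ := CliffordAlgebra (g.quad x)

/-- Sections of the Clifford bundle (no regularity included). -/
abbrev ClField : Type _ := Π x : M, Cl g x

/-- The inclusion of tangent vectors in the Clifford algebra. -/
abbrev toCl {x : M} (v : TangentSpace (𝓡 4) x) : Cl g x := CliffordAlgebra.ι (g.quad x) v

end Geometry

/-- The quadratic form of Minkowski space. -/
def minkowski : QuadraticForm ℝ (Fin 4 → ℝ) := QuadraticMap.weightedSumSquares ℝ eta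

/-- The spacetime algebra, the Clifford algebra of Minkowski space. -/
abbrev SpacetimeAlgebra : Type := CliffordAlgebra minkowski

/-- The basis of the spacetime algebra that corresponds to the exterior products
`m_{a₁} ∧ ⋯ ∧ m_{aₖ}`, `a₁ < ⋯ < aₖ`, of the canonical vectors. -/
def spacetimeBasis : Module.Basis (Finset (Fin 4)) ℝ SpacetimeAlgebra :=
  (Pi.basisFun ℝ (Fin 4)).ExteriorAlgebra.map (CliffordAlgebra.equivExterior minkowski).symm

section Frame

variable {M : Type*} [TopologicalSpace M] [ChartedSpace E4 M] [IsManifold (𝓡 4) ∞ M]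
  {g : LorentzMetric M} (e : Tetrad g)

namespace Tetrad

/-- The coframe `θ^b = η^{bb} g(e_b, ·)`, that is, `θ^b(w) = g(e^b, w)` for the reciprocal
frame `e^b = η^{bb} e_b`. -/
def coframe (b : Fin 4) (x : M) : Module.Dual ℝ (TangentSpace (𝓡 4) x) :=
  eta b • (g.val x (e.vec b x)).toLinearMap

lemma coframe_vec (a b : Fin 4) (x : M) :
    e.coframe b x (e.vec a x) = if a = b then 1 else 0 := by
  simp only [coframe, LinearMap.smul_apply, ContinuousLinearMap.coe_coe, e.orthonormal, etaMat,
    smul_eq_mul]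
  by_cases h : a = b
  · subst h; fin_cases a <;> simp [eta]
  · simp [h, Ne.symm h]

lemma linearIndependent (x : M) : LinearIndependent ℝ (fun a ↦ e.vec a x) := by
  rw [Fintype.linearIndependent_iff]
  intro c hc b
  have := congrArg (e.coframe b x) hc
  simpa [map_sum, coframe_vec] using this

/-- The tetrad as a basis of each tangent space. -/
def basis (x : M) : Module.Basis (Fin 4) ℝ (TangentSpace (𝓡 4) x) :=
  basisOfLinearIndependentOfCardEqFinrank (e.linearIndependent x)
    (by change Fintype.card (Fin 4) = Module.finrank ℝ E4; simp)

lemma basis_apply (x : M) (a : Fin 4) : e.basis x a = e.vec a x := by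
  simp [basis]

/-- The isometry of Minkowski space onto `T_x M` given by the tetrad, `c ↦ ∑ cᵃ e_a(x)`. -/
def isometry (x : M) : minkowski.IsometryEquiv (g.quad x) where
  toLinearEquiv := (e.basis x).equivFun.symm
  map_app' c := by
    simp [Module.Basis.equivFun_symm_apply, basis_apply, LorentzMetric.quad_apply, minkowski,
      QuadraticMap.weightedSumSquares_apply, Fin.sum_univ_four, e.orthonormal, etaMat, eta]

/-- The trivialization of the Clifford bundle given by the tetrad. -/
def gauge (x : M) : SpacetimeAlgebra ≃ₐ[ℝ] Cl g x :=
  CliffordAlgebra.equivOfIsometry (e.isometry x)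

/-- The Pfaff derivative `∂_v C`: it differentiates the components of the Clifford field `C`
with respect to the multivectors built from the tetrad. -/
def pfaff (C : ClField g) (x : M) (v : TangentSpace (𝓡 4) x) : Cl g x :=
  ∑ S : Finset (Fin 4),
    mvfderiv (𝓡 4) (fun y ↦ spacetimeBasis.repr ((e.gauge y).symm (C y)) S) x v •
      e.gauge x (spacetimeBasis S)

variable (D : LinearConnection M)

/-- The connection coefficients `ω_{v a}^b` in `D_v e_a = ω_{v a}^b e_b`. -/
def omega (x : M) (v : TangentSpace (𝓡 4) x) (a b : Fin 4) : ℝ :=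
  e.coframe b x (D (e.vec a) x v)

/-- The connection bivector `ω_v = ½ ω_v^{bc} e_b e_c`, with `ω_v^{bc} = η^{cc} ω_{v c}^b`. -/
def omegaBivector (x : M) (v : TangentSpace (𝓡 4) x) : Cl g x :=
  (1 / 2 : ℝ) • ∑ b, ∑ c, (eta c * e.omega D x v c b) •
    (toCl g (e.vec b x) * toCl g (e.vec c x))

/-- The covariant derivative of Clifford fields, `D_v C = ∂_v C + ½ [ω_v, C]`. -/
def clD (C : ClField g) (x : M) (v : TangentSpace (𝓡 4) x) : Cl g x :=
  e.pfaff C x v +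
    (1 / 2 : ℝ) • (e.omegaBivector D x v * C x - C x * e.omegaBivector D x v)

/-- The Pauli fields `σ_i = e_i e_0`, where `i = 0, 1, 2` here stands for the index
`1, 2, 3`. -/
def pauli (i : Fin 3) : ClField g := fun x ↦ toCl g (e.vec i.succ x) * toCl g (e.vec 0 x)

end Tetrad

end Frame

end Spacetime

end

/-!
The components of `σ_i = e_i e_0` in the tetrad are constant, so `D_v σ_i` is half the commutator
of `ω_v` with `e_i e_0`. Metric compatibility makes the coefficients of `ω_v` antisymmetric, hence
`½ [ω_v, e_a] = D_v e_a` (`Tetrad.half_commutator_omegaBivector`), and the commutator being a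
derivation gives `D_v σ_i = (D_v e_i) e_0 + e_i (D_v e_0)` (`Tetrad.clD_pauli`). As `e_0² = 1`, this
vanishes if and only if `D_v e_i = -e_i (D_v e_0) e_0`.

Put `u = D_v e_0`, which is orthogonal to `e_0`. If `e_i u e_0` is a vector, or if only
its contraction with `e^0` is a scalar, then `e_i u` is a scalar and `u` is a multiple of `e_i`.
For all `i` together this forces `u = 0` (`Tetrad.eq_zero_of_toCl_mul_scalar`). Each of the
three conditions on all the `i` is therefore equivalent to `D_v e_a = 0` for all `a`.

The rest follows by specialization. A parallel tetrad makes `D` flat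
(`flat_of_parallel_tetrad`), because on components the curvature is
`X (Y f) - Y (X f) - [X, Y] f`; that this is zero is deduced from the Jacobi identity
(`mvfderiv_mlieBracket`). For a geodesic `e_0`, Fermi transport along its integral lines amounts to
`D_{e_0} Y = 0` everywhere, because there is an integral line through each point
(`isFermiTransported_iff_of_isGeodesic`).
-/

namespace Spacetime

/-! ### Commutators with the connection bivector -/

section Algebra

lemma eta_mul_self (a : Fin 4) : eta a * eta a = 1 := by
  fin_cases a <;> simp [eta]

/-- For vectors `γ_a` satisfying the Clifford relations of an orthonormal frame and coefficients
`w` that are antisymmetric after lowering an index, the bivector `B = ½ w^{bc} γ_b γ_c` acts on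
vectors through `½ [B, γ_a] = w_a^b γ_b`. -/
lemma half_commutator_bivector {A : Type*} [Ring A] [Algebra ℝ A] (γ : Fin 4 → A)
    (hγ : ∀ a b, γ a * γ b + γ b * γ a = (2 * etaMat a b) • (1 : A))
    (w : Fin 4 → Fin 4 → ℝ) (hw : ∀ a b, eta b * w a b + eta a * w b a = 0) (a : Fin 4) :
    (1 / 2 : ℝ) • (((1 / 2 : ℝ) • ∑ b, ∑ c, (eta c * w c b) • (γ b * γ c)) * γ a -
      γ a * ((1 / 2 : ℝ) • ∑ b, ∑ c, (eta c * w c b) • (γ b * γ c))) = ∑ b, w a b • γ b := by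
  have key (b c : Fin 4) : γ b * γ c * γ a - γ a * (γ b * γ c) =
      (2 * etaMat c a) • γ b - (2 * etaMat a b) • γ c := by
    have h1 := congrArg (γ b * ·) (hγ c a)
    have h2 := congrArg (· * γ c) (hγ a b)
    simp only [mul_smul_comm, smul_mul_assoc, mul_one, one_mul] at h1 h2
    rw [← h1, ← h2]
    noncomm_ring
  have hanti (c : Fin 4) : eta c * w c a * eta a = -w a c := by
    linear_combination eta c * hw a c - w a c * eta_mul_self c
  have hdiag (c : Fin 4) : eta a * w a c * eta a = w a c := by
    linear_combination w a c * eta_mul_self a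
  have h1 : ∑ b, ∑ c, ((eta c * w c b) * etaMat c a) • γ b = ∑ b, w a b • γ b := by
    refine Finset.sum_congr rfl fun b _ ↦ ?_
    rw [Finset.sum_eq_single a]
    · simp [etaMat, hdiag]
    · intro c _ hc; simp [etaMat, hc]
    · simp
  have h2 : ∑ b, ∑ c, ((eta c * w c b) * etaMat a b) • γ c = -∑ b, w a b • γ b := by
    rw [Finset.sum_comm, ← Finset.sum_neg_distrib]
    refine Finset.sum_congr rfl fun c _ ↦ ?_
    rw [Finset.sum_eq_single a]
    · simp [etaMat, hanti]
    · intro b _ hb; simp [etaMat, Ne.symm hb]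
    · simp
  calc _ = (1 / 4 : ℝ) • ∑ b, ∑ c, (eta c * w c b) • (γ b * γ c * γ a - γ a * (γ b * γ c)) := by
        simp only [smul_mul_assoc, mul_smul_comm, Finset.sum_mul, Finset.mul_sum, smul_sub,
          Finset.sum_sub_distrib, smul_smul]
        norm_num
    _ = (1 / 2 : ℝ) • (∑ b, ∑ c, ((eta c * w c b) * etaMat c a) • γ b -
          ∑ b, ∑ c, ((eta c * w c b) * etaMat a b) • γ c) := by
        simp only [key, ← Finset.sum_sub_distrib, Finset.smul_sum]
        refine Finset.sum_congr rfl fun b _ ↦ Finset.sum_congr rfl fun c _ ↦ ?_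
        module
    _ = _ := by rw [h1, h2]; module

end Algebra

/-! ### The Clifford bundle in a tetrad -/

section Frame

variable {M : Type*} [TopologicalSpace M] [ChartedSpace E4 M] [IsManifold (𝓡 4) ∞ M]
  {g : LorentzMetric M}

lemma LorentzMetric.toCl_mul_add_swap (x : M) (v w : TangentSpace (𝓡 4) x) :
    toCl g v * toCl g w + toCl g w * toCl g v = (2 * g.val x v w) • (1 : Cl g x) := by
  rw [CliffordAlgebra.ι_mul_ι_add_swap, Algebra.algebraMap_eq_smul_one]
  congr 1
  simp only [QuadraticMap.polar, LorentzMetric.quad_apply, map_add, add_apply]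
  rw [g.symm x w v]
  ring

lemma LorentzMetric.toCl_mul_self (x : M) (v : TangentSpace (𝓡 4) x) :
    toCl g v * toCl g v = g.val x v v • (1 : Cl g x) := by
  rw [CliffordAlgebra.ι_sq_scalar, Algebra.algebraMap_eq_smul_one, LorentzMetric.quad_apply]

lemma algebraMap_cl_injective (x : M) : Function.Injective (algebraMap ℝ (Cl g x)) := by
  intro r s h
  have := congrArg (CliffordAlgebra.equivExterior (g.quad x)) h
  simpa [CliffordAlgebra.equivExterior, CliffordAlgebra.changeForm_algebraMap] using this

lemma toCl_injective (x : M) : Function.Injective (toCl g : TangentSpace (𝓡 4) x → Cl g x) := by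
  intro r s h
  have := congrArg (CliffordAlgebra.equivExterior (g.quad x)) h
  simpa [CliffordAlgebra.equivExterior, CliffordAlgebra.changeForm_ι] using this

lemma toCl_eq_zero_iff {x : M} {w : TangentSpace (𝓡 4) x} : toCl g w = 0 ↔ w = 0 := by
  rw [← (toCl_injective (g := g) x).eq_iff]
  simp only [toCl, map_zero]

namespace Tetrad

variable (e : Tetrad g)

lemma eq_sum_coframe (x : M) (w : TangentSpace (𝓡 4) x) :
    w = ∑ a, e.coframe a x w • e.vec a x := by
  have h (a : Fin 4) : e.coframe a x w = (e.basis x).repr w a := by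
    conv_lhs => rw [← (e.basis x).sum_repr w]
    simp [basis_apply, coframe_vec]
  simp_rw [h, ← basis_apply]
  exact ((e.basis x).sum_repr w).symm

lemma val_vec_eq_coframe (x : M) (w : TangentSpace (𝓡 4) x) (a : Fin 4) :
    g.val x (e.vec a x) w = eta a * e.coframe a x w := by
  simp [coframe, ← mul_assoc, eta_mul_self]

lemma toCl_covariantDerivative (D : LinearConnection M) (x : M) (v : TangentSpace (𝓡 4) x)
    (a : Fin 4) :
    toCl g (D (e.vec a) x v) = ∑ b, e.omega D x v a b • toCl g (e.vec b x) := by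
  conv_lhs => rw [e.eq_sum_coframe x (D (e.vec a) x v)]
  simp [omega]

lemma gauge_symm_vec (x : M) (a : Fin 4) :
    (e.gauge x).symm (toCl g (e.vec a x)) = CliffordAlgebra.ι minkowski (Pi.single a 1) := by
  rw [AlgEquiv.symm_apply_eq]
  change _ = CliffordAlgebra.map (e.isometry x).toIsometry (CliffordAlgebra.ι minkowski _)
  rw [CliffordAlgebra.map_apply_ι]
  congr 1
  change e.vec a x = (e.basis x).equivFun.symm (Pi.single a 1)
  simp [Module.Basis.equivFun_symm_apply, basis_apply, Pi.single_apply]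

/-- The components of `σ_i` with respect to the tetrad are constant, so `∂_v σ_i = 0`. -/
lemma pfaff_pauli (i : Fin 3) (x : M) (v : TangentSpace (𝓡 4) x) :
    e.pfaff (e.pauli i) x v = 0 := by
  simp [pfaff, pauli, gauge_symm_vec, mvfderiv_const]

variable {D : LinearConnection M}

lemma metric_vec (hD : IsLeviCivita D g) (x : M) (v : TangentSpace (𝓡 4) x) (a b : Fin 4) :
    g.val x (D (e.vec a) x v) (e.vec b x) + g.val x (e.vec a x) (D (e.vec b) x v) = 0 := by
  have hd (c : Fin 4) : IsDiffAt (e.vec c) x := (e.smooth c).mdifferentiableAt (by simp)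
  rw [← hD.metric _ _ x (hd a) (hd b) v]
  simp [e.orthonormal, mvfderiv_const]

lemma omega_antisymm (hD : IsLeviCivita D g) (x : M) (v : TangentSpace (𝓡 4) x) (a b : Fin 4) :
    eta b * e.omega D x v a b + eta a * e.omega D x v b a = 0 := by
  rw [omega, omega, ← val_vec_eq_coframe, ← val_vec_eq_coframe, g.symm]
  exact e.metric_vec hD x v a b

/-- On vector fields of the tetrad, the Clifford derivative is the Levi-Civita derivative:
`½ [ω_v, e_a] = D_v e_a`. -/
lemma half_commutator_omegaBivector (hD : IsLeviCivita D g) (x : M)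
    (v : TangentSpace (𝓡 4) x) (a : Fin 4) :
    (1 / 2 : ℝ) • (e.omegaBivector D x v * toCl g (e.vec a x) -
      toCl g (e.vec a x) * e.omegaBivector D x v) = toCl g (D (e.vec a) x v) := by
  rw [toCl_covariantDerivative]
  exact half_commutator_bivector (fun a ↦ toCl g (e.vec a x))
    (fun a b ↦ by rw [LorentzMetric.toCl_mul_add_swap, e.orthonormal]) _ (e.omega_antisymm hD x v) a

/-- The Leibniz rule `D_v σ_i = (D_v e_i) e_0 + e_i (D_v e_0)`. It holds because the commutator
with `ω_v` is a derivation. -/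
lemma clD_pauli (hD : IsLeviCivita D g) (x : M) (v : TangentSpace (𝓡 4) x) (i : Fin 3) :
    e.clD D (e.pauli i) x v = toCl g (D (e.vec i.succ) x v) * toCl g (e.vec 0 x) +
      toCl g (e.vec i.succ x) * toCl g (D (e.vec 0) x v) := by
  rw [clD, pfaff_pauli, zero_add, ← e.half_commutator_omegaBivector hD,
    ← e.half_commutator_omegaBivector hD, pauli, smul_mul_assoc, mul_smul_comm, ← smul_add]
  congr 1
  noncomm_ring

/-- Multiply the Leibniz rule on the right by `e_0`, whose square is `1`. -/
lemma clD_pauli_eq_zero_iff (hD : IsLeviCivita D g) (x : M) (v : TangentSpace (𝓡 4) x) (i : Fin 3) :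
    e.clD D (e.pauli i) x v = 0 ↔ toCl g (D (e.vec i.succ) x v) =
      -(toCl g (e.vec i.succ x) * toCl g (D (e.vec 0) x v) * toCl g (e.vec 0 x)) := by
  have h0 : toCl g (e.vec 0 x) * toCl g (e.vec 0 x) = 1 := by
    rw [LorentzMetric.toCl_mul_self, e.orthonormal]
    simp [etaMat, eta]
  rw [e.clD_pauli hD]
  constructor
  · intro h
    have := congrArg (· * toCl g (e.vec 0 x)) h
    simp only [add_mul, zero_mul, mul_assoc, h0, mul_one] at this
    rw [mul_assoc]
    exact eq_neg_of_add_eq_zero_left this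
  · intro h
    rw [h, neg_mul, mul_assoc _ (toCl g (e.vec 0 x)), h0, mul_one, neg_add_cancel]

lemma coframe_zero_D_vec_zero (hD : IsLeviCivita D g) (x : M) (v : TangentSpace (𝓡 4) x) :
    e.coframe 0 x (D (e.vec 0) x v) = 0 := by
  have := e.omega_antisymm hD x v 0 0
  simpa [eta, omega] using this

/-- A vector `u` with `e_i u` scalar is a multiple of `e_i`, because `e_i² = -1`; it vanishes
because this holds for two different indices `i`. -/
lemma eq_zero_of_toCl_mul_scalar (x : M) (u : TangentSpace (𝓡 4) x) (r : Fin 3 → ℝ)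
    (h : ∀ i : Fin 3, toCl g (e.vec i.succ x) * toCl g u = algebraMap ℝ (Cl g x) (r i)) :
    u = 0 := by
  have hu (i : Fin 3) : u = (-r i) • e.vec i.succ x := by
    apply toCl_injective (g := g) x
    have h1 := congrArg (toCl g (e.vec i.succ x) * ·) (h i)
    simp only [← mul_assoc, LorentzMetric.toCl_mul_self, e.orthonormal] at h1
    rw [Algebra.algebraMap_eq_smul_one, mul_smul_comm, mul_one] at h1
    have hη : etaMat i.succ i.succ = -1 := by fin_cases i <;> simp [etaMat, eta]
    rw [hη] at h1
    simp only [neg_smul, one_smul, neg_mul, one_mul] at h1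
    rw [toCl, toCl, map_smul, neg_smul, ← h1, neg_neg]
  -- `e^1` applied to `u = -r₀ e_1 = -r₁ e_2`
  have hc := congrArg (e.coframe 1 x) ((hu 0).symm.trans (hu 1))
  simp [coframe_vec] at hc
  rw [hu 0, hc, neg_zero, zero_smul]

/-- For `u` orthogonal to `e_0`, the contraction of `e_i u e_0` with `e^0` only removes the last
factor. -/
lemma contractLeft_coframe_zero (x : M) (u : TangentSpace (𝓡 4) x) (i : Fin 3)
    (hu : e.coframe 0 x u = 0) :
    CliffordAlgebra.contractLeft (e.coframe 0 x)
      (toCl g (e.vec i.succ x) * toCl g u * toCl g (e.vec 0 x)) =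
      toCl g (e.vec i.succ x) * toCl g u := by
  rw [mul_assoc, CliffordAlgebra.contractLeft_ι_mul, CliffordAlgebra.contractLeft_ι_mul,
    CliffordAlgebra.contractLeft_ι, hu]
  simp [coframe_vec]

lemma sum_omega_smul (x : M) (v : TangentSpace (𝓡 4) x) (i : Fin 3) :
    ∑ a, e.omega D x v 0 a •
      (toCl g (e.vec i.succ x) * toCl g (e.vec a x) * toCl g (e.vec 0 x)) =
    toCl g (e.vec i.succ x) * toCl g (D (e.vec 0) x v) * toCl g (e.vec 0 x) := by
  simp only [toCl_covariantDerivative, Finset.mul_sum, Finset.sum_mul, mul_smul_comm,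
    smul_mul_assoc]

end Tetrad

end Frame

/-! ### The Lie bracket as a commutator of derivations, and flatness -/

section Bracket

variable {M : Type*} [TopologicalSpace M] [ChartedSpace E4 M] [IsManifold (𝓡 4) ∞ M]
variable {g : LorentzMetric M}

lemma IsSmooth.isDiffAt {X : VField M} (hX : IsSmooth X) (x : M) : IsDiffAt X x :=
  hX.mdifferentiableAt (by simp)

lemma IsSmooth.smul {f : M → ℝ} {X : VField M} (hf : ContMDiff (𝓡 4) 𝓘(ℝ, ℝ) ∞ f)
    (hX : IsSmooth X) : IsSmooth (f • X) :=
  ContMDiff.smul_section hf hX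

lemma IsSmooth.mlieBracket {X Y : VField M} (hX : IsSmooth X) (hY : IsSmooth Y) :
    IsSmooth (VectorField.mlieBracket (𝓡 4) X Y) := by
  have : IsManifold (𝓡 4) ((⊤ : ℕ∞) + 1) M := by simpa using! ‹IsManifold (𝓡 4) ∞ M›
  have : IsManifold (𝓡 4) (minSmoothness ℝ 2) M := by
    rw [minSmoothness_of_isRCLikeNormedField]; infer_instance
  exact ContDiff.mlieBracket_vectorField (m := ⊤) (n := ⊤) hX hY (by simp)

lemma LorentzMetric.contMDiff_apply (g : LorentzMetric M) {X Y : VField M} (hX : IsSmooth X)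
    (hY : IsSmooth Y) : ContMDiff (𝓡 4) 𝓘(ℝ, ℝ) ∞ (fun x ↦ g.val x (X x) (Y x)) := by
  have := ContMDiff.clm_bundle_apply₂ (F₁ := E4) (F₂ := E4) (F₃ := ℝ)
    (E₁ := (TangentSpace (𝓡 4) : M → Type _)) (E₂ := (TangentSpace (𝓡 4) : M → Type _))
    (E₃ := Bundle.Trivial M ℝ) (b := fun x ↦ x) (ψ := g.val) (v := X) (w := Y)
    (IB := 𝓡 4) (IM := 𝓡 4) (n := ∞) g.contMDiff hX hY
  exact fun x ↦ ((Bundle.contMDiffAt_section x).1 (this x))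

lemma contMDiff_directional {f : M → ℝ} {Y : VField M}
    (hf : ContMDiff (𝓡 4) 𝓘(ℝ, ℝ) ∞ f) (hY : IsSmooth Y) :
    ContMDiff (𝓡 4) 𝓘(ℝ, ℝ) ∞ (fun x ↦ mvfderiv (𝓡 4) f x (Y x)) := by
  have h := (hf.contMDiff_tangentMap (m := ∞) (by simp)).comp hY
  exact (contMDiff_snd_tangentBundle_modelSpace ℝ 𝓘(ℝ, ℝ)).comp h

open VectorField in
/-- `[X, Y] f = X (Y f) - Y (X f)`. Expand the Jacobi identity for `X`, `Y` and `f Z` by the product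
rule and subtract `f` times the Jacobi identity for `X`, `Y` and `Z`: what remains is the difference
of the two sides, multiplied by `Z`. The auxiliary field `Z` only has to be nonzero at the point. -/
lemma mvfderiv_mlieBracket {f : M → ℝ} {X Y Z : VField M}
    (hf : ContMDiff (𝓡 4) 𝓘(ℝ, ℝ) ∞ f) (hX : IsSmooth X) (hY : IsSmooth Y) (hZ : IsSmooth Z)
    (x : M) (hx : Z x ≠ 0) :
    mvfderiv (𝓡 4) f x (mlieBracket (𝓡 4) X Y x) =
      mvfderiv (𝓡 4) (fun y ↦ mvfderiv (𝓡 4) f y (Y y)) x (X x) -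
        mvfderiv (𝓡 4) (fun y ↦ mvfderiv (𝓡 4) f y (X y)) x (Y x) := by
  have hd {h : M → ℝ} (hh : ContMDiff (𝓡 4) 𝓘(ℝ, ℝ) ∞ h) (y : M) :
      MDifferentiableAt (𝓡 4) 𝓘(ℝ, ℝ) h y := hh.mdifferentiableAt (by simp)
  have br (V W : VField M) {h : M → ℝ} (hh : ContMDiff (𝓡 4) 𝓘(ℝ, ℝ) ∞ h) (hW : IsSmooth W) :
      mlieBracket (𝓡 4) V (h • W) =
        (fun y ↦ mvfderiv (𝓡 4) h y (V y)) • W + h • mlieBracket (𝓡 4) V W := by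
    ext1 y
    exact mlieBracket_smul_right (hd hh y) (hW.isDiffAt y)
  have br2 (V W : VField M) (hV : IsSmooth V) (hW : IsSmooth W) :
      mlieBracket (𝓡 4) V (mlieBracket (𝓡 4) W (f • Z)) x =
        mvfderiv (𝓡 4) (fun y ↦ mvfderiv (𝓡 4) f y (W y)) x (V x) • Z x +
        mvfderiv (𝓡 4) f x (W x) • mlieBracket (𝓡 4) V Z x +
        (mvfderiv (𝓡 4) f x (V x) • mlieBracket (𝓡 4) W Z x +
          f x • mlieBracket (𝓡 4) V (mlieBracket (𝓡 4) W Z) x) := by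
    have hWf := contMDiff_directional hf hW
    rw [br W Z hf hZ, mlieBracket_add_right ((hZ.smul hWf).isDiffAt x)
      (((hW.mlieBracket hZ).smul hf).isDiffAt x),
      br _ _ hWf hZ, br _ _ hf (hW.mlieBracket hZ)]
    rfl
  have : IsManifold (𝓡 4) (minSmoothness ℝ 3) M := by
    rw [minSmoothness_of_isRCLikeNormedField]; infer_instance
  have le2 : minSmoothness ℝ 2 ≤ ∞ := by
    rw [minSmoothness_of_isRCLikeNormedField]; exact ENat.LEInfty.out
  have jac (W : VField M) (hW : IsSmooth W) := leibniz_identity_mlieBracket_apply (x := x)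
    ((hX x).of_le le2) ((hY x).of_le le2) ((hW x).of_le le2)
  have j1 := jac _ (hZ.smul hf)
  have j2 := jac _ hZ
  rw [br2 X Y hX hY, br2 Y X hY hX, br _ _ hf hZ] at j1
  simp only [Pi.add_apply, Pi.smul_apply'] at j1
  rw [j2] at j1
  have h0 : (mvfderiv (𝓡 4) f x (mlieBracket (𝓡 4) X Y x) -
      (mvfderiv (𝓡 4) (fun y ↦ mvfderiv (𝓡 4) f y (Y y)) x (X x) -
        mvfderiv (𝓡 4) (fun y ↦ mvfderiv (𝓡 4) f y (X y)) x (Y x))) • Z x = 0 := by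
    rw [← sub_eq_zero] at j1
    rw [← neg_eq_zero, ← j1]
    module
  exact sub_eq_zero.1 ((smul_eq_zero.1 h0).resolve_right hx)

/-- Write `Z = f^a e_a`. Then `D_Y Z = (Y f^a) e_a`, so the curvature is
`(X (Y f^a) - Y (X f^a) - [X, Y] f^a) e_a = 0`. -/
lemma flat_of_parallel_tetrad (D : LinearConnection M) (e : Tetrad g)
    (he : ∀ a, IsParallel D (e.vec a)) : IsFlat D := by
  intro X Y Z hX hY hZ x
  have hne : e.vec 0 x ≠ 0 := (e.linearIndependent x).ne_zero 0
  let f (a : Fin 4) : M → ℝ := fun y ↦ e.coframe a y (Z y)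
  have hf (a : Fin 4) : ContMDiff (𝓡 4) 𝓘(ℝ, ℝ) ∞ (f a) :=
    contMDiff_const.mul (g.contMDiff_apply (e.smooth a) hZ)
  have hZf : Z = fun y ↦ ∑ a, f a y • e.vec a y := by
    ext1 y
    exact e.eq_sum_coframe y (Z y)
  have hDsum (h : Fin 4 → M → ℝ) (hh : ∀ a, ContMDiff (𝓡 4) 𝓘(ℝ, ℝ) ∞ (h a)) (y : M)
      (v : TangentSpace (𝓡 4) y) :
      D (fun y ↦ ∑ a, h a y • e.vec a y) y v = ∑ a, mvfderiv (𝓡 4) (h a) y v • e.vec a y := by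
    have hs (a : Fin 4) : IsSmooth (h a • e.vec a) := (e.smooth a).smul (hh a)
    have hl (a : Fin 4) : D (h a • e.vec a) y v = mvfderiv (𝓡 4) (h a) y v • e.vec a y := by
      rw [D.isCovariantDerivativeOnUniv.leibniz ((e.smooth a).isDiffAt y)
        ((hh a).mdifferentiableAt (by simp))]
      simp [he a y v]
    -- the additivity of `D` is stated for binary sums
    have heq : (fun y ↦ ∑ a, h a y • e.vec a y) =
        h 0 • e.vec 0 + h 1 • e.vec 1 + h 2 • e.vec 2 + h 3 • e.vec 3 := by
      ext1 y
      simp [Fin.sum_univ_four]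
    have hadd {V W : VField M} (hV : IsSmooth V) (hW : IsSmooth W) :
        D (V + W) y v = D V y v + D W y v := by
      rw [D.isCovariantDerivativeOnUniv.add (hV.isDiffAt y) (hW.isDiffAt y)]
      rfl
    have h01 := ContMDiff.add_section (hs 0) (hs 1)
    have h012 := ContMDiff.add_section h01 (hs 2)
    rw [heq, hadd h012 (hs 3), hadd h01 (hs 2), hadd (hs 0) (hs 1), hl, hl, hl, hl,
      Fin.sum_univ_four]
  rw [curvature]
  simp only [hZf, hDsum f hf]
  rw [hDsum _ fun a ↦ contMDiff_directional (hf a) hY,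
    hDsum _ fun a ↦ contMDiff_directional (hf a) hX,
    ← Finset.sum_sub_distrib, ← Finset.sum_sub_distrib]
  refine Finset.sum_eq_zero fun a _ ↦ ?_
  rw [mvfderiv_mlieBracket (hf a) hX hY (e.smooth 0) x hne]
  module

end Bracket

/-! ### Fermi transport along a geodesic field -/

section Transport

variable {M : Type*} [TopologicalSpace M] [ChartedSpace E4 M] [IsManifold (𝓡 4) ∞ M]
  {g : LorentzMetric M}

/-- For a geodesic field the acceleration vanishes, so the Fermi condition reads `D_u Y = 0` along
the integral lines. These pass through every point, since a smooth field has local integral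
curves. -/
lemma isFermiTransported_iff_of_isGeodesic {D : LinearConnection M} {u Y : VField M}
    (hu : IsSmooth u) (hgeo : IsGeodesic D u) :
    IsFermiTransported g D u Y ↔ ∀ x, D Y x (u x) = 0 := by
  constructor
  · intro h x
    obtain ⟨γ, hγ, hc⟩ := exists_isMIntegralCurveAt_of_contMDiffAt_boundaryless (I := 𝓡 4) (v := u)
      0 ((hu x).of_le (n := ∞) (by simp))
    obtain ⟨ε, hε, hc⟩ := isMIntegralCurveAt_iff'.1 hc
    have := h γ _ Metric.isOpen_ball (Real.ball_eq_Ioo 0 ε ▸ Set.ordConnected_Ioo) hc 0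
      (Metric.mem_ball_self hε)
    rw [hγ, hgeo x] at this
    simpa using this
  · intro h γ J _ _ _ t _
    rw [h, hgeo]
    simp

/-! ### The three conditions on the Pauli fields -/

namespace Tetrad

variable (e : Tetrad g) {D : LinearConnection M}

/-- The contraction with `e^0` alone makes `e_i (D_v e_0)` a scalar for every `i`, which forces
`D_v e_0 = 0`. -/
lemma D_vec_zero_eq_zero_of_contractLeft (hD : IsLeviCivita D g) (x : M)
    (v : TangentSpace (𝓡 4) x) (r : Fin 3 → ℝ)
    (h : ∀ i : Fin 3, algebraMap ℝ (Cl g x) (r i) = CliffordAlgebra.contractLeft (e.coframe 0 x)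
      (toCl g (e.vec i.succ x) * toCl g (D (e.vec 0) x v) * toCl g (e.vec 0 x))) :
    D (e.vec 0) x v = 0 :=
  e.eq_zero_of_toCl_mul_scalar x _ r fun i ↦ by
    rw [h, e.contractLeft_coframe_zero x _ i (e.coframe_zero_D_vec_zero hD x v)]

/-- If `e_i (D_v e_0) e_0` is a vector for every `i`, then `D_v e_0 = 0`. The sign of that vector
does not matter, which is why the conditions with `+` and with `-` agree once all `i` are taken
together. -/
lemma D_vec_zero_eq_zero_of_eq (hD : IsLeviCivita D g) (x : M)
    (v : TangentSpace (𝓡 4) x) (w : Fin 3 → TangentSpace (𝓡 4) x)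
    (h : ∀ i : Fin 3, toCl g (w i) =
      toCl g (e.vec i.succ x) * toCl g (D (e.vec 0) x v) * toCl g (e.vec 0 x)) :
    D (e.vec 0) x v = 0 :=
  e.D_vec_zero_eq_zero_of_contractLeft hD x v (fun i ↦ e.coframe 0 x (w i)) fun i ↦ by
    rw [← h, CliffordAlgebra.contractLeft_ι]

lemma clD_pauli_eq_zero_iff_of_D_vec_zero (hD : IsLeviCivita D g) {x : M}
    {v : TangentSpace (𝓡 4) x} (h0 : D (e.vec 0) x v = 0) (i : Fin 3) :
    e.clD D (e.pauli i) x v = 0 ↔ D (e.vec i.succ) x v = 0 := by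
  rw [e.clD_pauli_eq_zero_iff hD, h0]
  simp only [map_zero, mul_zero, zero_mul, neg_zero]
  exact toCl_eq_zero_iff

/-- All three `σ_i` are constant in the direction `v` exactly when the whole tetrad is. -/
lemma forall_clD_pauli_eq_zero_iff (hD : IsLeviCivita D g) (x : M) (v : TangentSpace (𝓡 4) x) :
    (∀ i : Fin 3, e.clD D (e.pauli i) x v = 0) ↔ ∀ a, D (e.vec a) x v = 0 := by
  constructor
  · intro h
    have h0 : D (e.vec 0) x v = 0 :=
      e.D_vec_zero_eq_zero_of_eq hD x v (fun i ↦ -D (e.vec i.succ) x v) fun i ↦ by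
        rw [← neg_eq_iff_eq_neg.2 ((e.clD_pauli_eq_zero_iff hD x v i).1 (h i))]
        simp only [toCl, map_neg]
    exact Fin.cases h0 fun i ↦ (e.clD_pauli_eq_zero_iff_of_D_vec_zero hD h0 i).1 (h i)
  · exact fun h i ↦ (e.clD_pauli_eq_zero_iff_of_D_vec_zero hD (h 0) i).2 (h i.succ)

lemma forall_toCl_eq_iff (hD : IsLeviCivita D g) (x : M) (v : TangentSpace (𝓡 4) x) :
    (∀ i : Fin 3, toCl g (D (e.vec i.succ) x v) =
      toCl g (e.vec i.succ x) * toCl g (D (e.vec 0) x v) * toCl g (e.vec 0 x)) ↔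
    ∀ a, D (e.vec a) x v = 0 := by
  constructor
  · intro h
    have h0 := e.D_vec_zero_eq_zero_of_eq hD x v _ h
    exact Fin.cases h0 fun i ↦ toCl_eq_zero_iff.1 ((h i).trans (by simp [h0]))
  · intro h i
    simp [h]

lemma forall_omega_eq_iff (hD : IsLeviCivita D g) (x : M) (v : TangentSpace (𝓡 4) x) :
    (∀ (i : Fin 3) (b : Fin 4), algebraMap ℝ (Cl g x) (e.omega D x v i.succ b) =
      CliffordAlgebra.contractLeft (e.coframe b x) (∑ a, e.omega D x v 0 a •
        (toCl g (e.vec i.succ x) * toCl g (e.vec a x) * toCl g (e.vec 0 x)))) ↔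
    ∀ a, D (e.vec a) x v = 0 := by
  simp only [sum_omega_smul]
  constructor
  · intro h
    have h0 := e.D_vec_zero_eq_zero_of_contractLeft hD x v _ fun i ↦ h i 0
    refine Fin.cases h0 fun i ↦ ?_
    rw [e.eq_sum_coframe x (D (e.vec i.succ) x v)]
    refine Finset.sum_eq_zero fun b _ ↦ ?_
    have hb : e.omega D x v i.succ b = 0 := algebraMap_cl_injective (g := g) x (by simp [h i b, h0])
    rw [omega] at hb
    rw [hb, zero_smul]
  · intro h i b
    simp [omega, h]

end Tetrad

end Transport

end Spacetime

open Spacetime CliffordAlgebra in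
theorem mainTheorem9 {M : Type*} [TopologicalSpace M] [ChartedSpace E4 M]
    [IsManifold (𝓡 4) ∞ M] (g : LorentzMetric M) (D : LinearConnection M)
    (hD : IsLeviCivita D g) (e : Tetrad g) :
    -- the equivalences hold at each point and in each direction
    (∀ (x : M) (v : TangentSpace (𝓡 4) x),
      -- each single `i`
      (∀ i : Fin 3, e.clD D (e.pauli i) x v = 0 ↔
        toCl g (D (e.vec i.succ) x v) =
          -(toCl g (e.vec i.succ x) * toCl g (D (e.vec 0) x v) * toCl g (e.vec 0 x))) ∧
      -- all `i` together
      ((∀ i : Fin 3, e.clD D (e.pauli i) x v = 0) ↔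
        ∀ i : Fin 3, toCl g (D (e.vec i.succ) x v) =
          toCl g (e.vec i.succ x) * toCl g (D (e.vec 0) x v) * toCl g (e.vec 0 x)) ∧
      -- in components
      ((∀ i : Fin 3, e.clD D (e.pauli i) x v = 0) ↔
        ∀ (i : Fin 3) (b : Fin 4), algebraMap ℝ (Cl g x) (e.omega D x v i.succ b) =
          contractLeft (e.coframe b x) (∑ a, e.omega D x v 0 a •
            (toCl g (e.vec i.succ x) * toCl g (e.vec a x) * toCl g (e.vec 0 x))))) ∧
    -- case (i): `e_0` is parallel
    (IsParallel D (e.vec 0) →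
      (∀ i : Fin 3, (∀ x v, e.clD D (e.pauli i) x v = 0) ↔ IsParallel D (e.vec i.succ)) ∧
      ((∀ (i : Fin 3) x v, e.clD D (e.pauli i) x v = 0) →
        (∀ i : Fin 3, IsFermiTransported g D (e.vec 0) (e.vec i.succ)) ∧
        (∀ a b x, D (e.vec b) x (e.vec a x) = 0) ∧
        (∀ b, IsParallel D (e.vec b)) ∧ IsTeleparallel g D ∧ IsFlat D)) ∧
    -- case (ii): `e_0` is geodesic
    (IsGeodesic D (e.vec 0) →
      (∀ i : Fin 3, (∀ x, e.clD D (e.pauli i) x (e.vec 0 x) = 0) ↔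
        ∀ x, D (e.vec i.succ) x (e.vec 0 x) = 0) ∧
      (∀ i : Fin 3, (∀ x, e.clD D (e.pauli i) x (e.vec 0 x) = 0) ↔
        IsFermiTransported g D (e.vec 0) (e.vec i.succ)) ∧
      ((∀ (i : Fin 3) x v, e.clD D (e.pauli i) x v = 0) → ∀ a,
        (∀ x, D (e.vec a) x (e.vec 0 x) = 0) ∧
        IsFermiTransported g D (e.vec 0) (e.vec a))) := by
  refine ⟨fun x v ↦ ⟨e.clD_pauli_eq_zero_iff hD x v, ?_, ?_⟩, fun h0 ↦ ⟨fun i ↦ ?_, fun h ↦ ?_⟩,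
    fun hgeo ↦ ⟨fun i ↦ ?_, fun i ↦ ?_, fun h a ↦ ?_⟩⟩
  · rw [e.forall_clD_pauli_eq_zero_iff hD, e.forall_toCl_eq_iff hD]
  · rw [e.forall_clD_pauli_eq_zero_iff hD, e.forall_omega_eq_iff hD]
  · exact forall₂_congr fun x v ↦ e.clD_pauli_eq_zero_iff_of_D_vec_zero hD (h0 x v) i
  · have hpar (a : Fin 4) : IsParallel D (e.vec a) := fun x v ↦
      (e.forall_clD_pauli_eq_zero_iff hD x v).1 (fun i ↦ h i x v) a
    exact ⟨fun i ↦ (isFermiTransported_iff_of_isGeodesic (e.smooth 0) fun x ↦ h0 x _).2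
      fun x ↦ hpar _ x _, fun a b x ↦ hpar b x _, hpar, ⟨e, hpar⟩, flat_of_parallel_tetrad D e hpar⟩
  · exact forall_congr' fun x ↦ e.clD_pauli_eq_zero_iff_of_D_vec_zero hD (hgeo x) i
  · rw [isFermiTransported_iff_of_isGeodesic (e.smooth 0) hgeo]
    exact forall_congr' fun x ↦ e.clD_pauli_eq_zero_iff_of_D_vec_zero hD (hgeo x) i
  · have ha (x : M) : D (e.vec a) x (e.vec 0 x) = 0 :=
      (e.forall_clD_pauli_eq_zero_iff hD x _).1 (fun i ↦ h i x _) a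
    exact ⟨ha, (isFermiTransported_iff_of_isGeodesic (e.smooth 0) hgeo).2 ha⟩
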